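/- Let $g\ge 2$ and let $$G_g=\{(A_1,\dots,A_{2g})\in SL_2(\mathbb R)^{2g}: [A_1,A_2][A_3,A_4]\cdots[A_{2g-1},A_{2g}]=I\},\qquad [A,B]=ABA^{-1}B^{-1},$$ with the topology induced from $SL_2(\mathbb R)^{2g}$. For $\mathcal A=(A_1,\dots,A_{2g})\in G_g$ let $\Gamma_{\mathcal A}$ be the subgroup of $SL_2(\mathbb R)$ generated by $A_1,\dots,A_{2g}$, acting on the hyperbolic plane $\mathbb H$ (curvature $-1$) by Möbius transformations. Let the length spectrum $\mathrm{Lsp}(\mathcal A)$ be the set of all $l>0$ for which there are an element $B\in\Gamma_{\mathcal A}$ and a complete unit-speed geodesic $\gamma:\mathbb R\to\mathbb H$ with $B\gamma(t)=\gamma(t+l)$ for all $t\in\mathbb R$ (that is, the lengths of the closed geodesics defined by the elements of $\Gamma_{\mathcal A}$; when $\Gamma_{\mathcal A}$ is the Fuchsian group of a closed hyperbolic surface, this is the length spectrum of the surface). Say that $\mathcal A$ satisfies exponential separation if there are constants $C,\beta>0$ such that $$|l_2-l_1|>C e^{-\beta\max(l_1,l_2)}\qquad\text{for all } l_1\ne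 l_2 \text{ in } \mathrm{Lsp}(\mathcal A).$$ Then the set of $\mathcal A\in G_g$ for which exponential separation fails is topologically generic (residual) in $G_g$, i.e. it contains a countable intersection of dense open subsets of $G_g$. -/

import Mathlib

open scoped MatrixGroups commutatorElement

/-- The representation variety `G_g`: the `2g`-tuples `(A₁, …, A_{2g})` in `SL₂(ℝ)` with
`[A₁, A₂] [A₃, A₄] ⋯ [A_{2g-1}, A_{2g}] = I` (indices are shifted to start from `0`), where
`[A, B] = A B A⁻¹ B⁻¹`.  It carries the topology induced from `SL₂(ℝ)^{2g}`. -/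
def surfaceTuples (g : ℕ) : Set (Fin (2 * g) → SL(2, ℝ)) :=
  {A | (List.ofFn fun i : Fin g =>
      ⁅A ⟨2 * i.val, by omega⟩, A ⟨2 * i.val + 1, by omega⟩⁆).prod = 1}

/-- The length spectrum of `Γ \ ℍ`: the set of all `l > 0` for which some element of `Γ` translates
a complete unit-speed geodesic of the hyperbolic plane by `l` along itself, that is, for which a
geodesic of `ℍ` projects to a closed geodesic of length `l`. -/
def lengthSpectrum (Γ : Subgroup SL(2, ℝ)) : Set ℝ :=
  {l | 0 < l ∧ ∃ γ : ℝ → UpperHalfPlane, Isometry γ ∧ ∃ B ∈ Γ, ∀ t : ℝ, B • γ t = γ (t + l)}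

/-- Exponential separation of a set of lengths: there are `C, β > 0` such that
`|l₂ - l₁| > C exp (-β max (l₁, l₂))` for all distinct lengths `l₁, l₂`. -/
def ExponentiallySeparated (L : Set ℝ) : Prop :=
  ∃ C > 0, ∃ β > 0, ∀ l₁ ∈ L, ∀ l₂ ∈ L, l₁ ≠ l₂ →
    |l₂ - l₁| > C * Real.exp (-β * max l₁ l₂)

/-!
For each `n`, let `smallGapTuples _ n` be the set of tuples for which some multiples of the
translation lengths of two hyperbolic words are distinct but differ by less than
`exp (-n max) / (n + 1)`. A hyperbolic element translates its axis (`exists_axis`), so these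
multiples lie in the length spectrum, and a tuple in all these sets is not exponentially separated.
The sets are open because translation lengths depend continuously on the tuple. The theorem thus
amounts to their density in the representation variety.

Density follows once every tuple, or tuples arbitrarily close to it, starts a path in the variety
along which one word keeps a constant hyperbolic trace while the trace of another one varies without
becoming elliptic (`mem_closure_of_path`). By the intermediate value theorem the ratio of the two
translation lengths takes a value arbitrarily close to, but different from, a rational `p / q`; the
corresponding multiples of the lengths then have a nonzero gap as small as desired, while the
multiples themselves stay bounded, and so the gap allowed by `smallGapTuples` stays bounded below.

The paths are twists: if `Z` commutes with `Y` then `⁅X Z, Y⁆ = ⁅X, Y⁆`, so a member of a pair may be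
multiplied by elements of the centralizer of the other member. The elements
`(1 + s Y) / √(1 + s tr Y + s²)` of this centralizer make all traces along the twist explicit. For a
pair `(X, Y)` put `κ = tr ⁅X, Y⁆`, so that `κ = 2 - det (X Y - Y X)`.

* If `κ > 2`, the twist fixes the hyperbolic element `⁅X, Y⁆`, and
  `tr ⁅X², Y⁆ = 2 + (tr X)² (κ - 2)` varies (`mem_closure_of_two_lt_trace_commutator`).
* If `κ ≤ 2` and `Y` is hyperbolic, then `X` is never elliptic, and its trace varies under the twist
  along `Y` (`mem_closure_of_hyperbolic`).
* If `κ ≤ 2` and both traces are `±2`, the pair commutes and is a limit of commuting pairs with a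
  hyperbolic member (`mem_closure_of_parabolic`).
* Otherwise every pair contains an elliptic element and commutes. As `g ≥ 2`, there are two pairs.
  One of them may be conjugated freely, which makes elliptic elements `E` and `F` of the two pairs
  have different fixed points, so that `⁅E, F⁆` is hyperbolic. Twisting the partner `X` of `E` along
  `E` then moves `tr ⁅X, F⁆` and fixes `⁅E, F⁆` (`mem_closure_of_elliptic`).
-/

/-! ### Axes of hyperbolic elements -/

/-- The translation length `2 arcosh (|tr B| / 2)` of `B` on the hyperbolic plane; it is meaningful
for `2 < |tr B|`. -/
noncomputable def translationLength (B : SL(2, ℝ)) : ℝ :=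
  2 * Real.arcosh (|B.val.trace| / 2)

theorem translationLength_pos {B : SL(2, ℝ)} (hB : 2 < |B.val.trace|) :
    0 < translationLength B :=
  mul_pos two_pos (Real.arcosh_pos (by linarith))

/-- A hyperbolic matrix is diagonalized by an element of `SL₂(ℝ)`, with its eigenvalues in any
prescribed order. -/
theorem exists_mul_eq_mul_diagonal (B : SL(2, ℝ)) {μ ν : ℝ} (hμν : μ * ν = 1) (hne : μ ≠ ν)
    (htr : B.val.trace = μ + ν) :
    ∃ P : SL(2, ℝ), (B.val * P.val) = P.val * !![μ, 0; 0, ν] := by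
  have hdet := B.det_coe
  rw [Matrix.det_fin_two] at hdet
  rw [Matrix.trace_fin_two] at htr
  obtain ⟨a, ha⟩ : ∃ a, a = B.val 0 0 := ⟨_, rfl⟩
  obtain ⟨b, hb⟩ : ∃ b, b = B.val 0 1 := ⟨_, rfl⟩
  obtain ⟨c, hc⟩ : ∃ c, c = B.val 1 0 := ⟨_, rfl⟩
  obtain ⟨d, hd⟩ : ∃ d, d = B.val 1 1 := ⟨_, rfl⟩
  have hB : B.val = !![a, b; c, d] := by
    rw [ha, hb, hc, hd]; exact Matrix.eta_fin_two _
  rw [← ha, ← hb, ← hc, ← hd] at hdet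
  rw [← ha, ← hd] at htr
  rw [hB]
  have hne' : μ - ν ≠ 0 := sub_ne_zero.2 hne
  -- for `c ≠ 0` the eigenvectors are `(μ - d, c)` and `(ν - d, c)`
  by_cases hc0 : c = 0
  · subst hc0
    have hroot : (a - μ) * (a - ν) = 0 := by
      linear_combination hμν + a * htr - hdet
    rcases mul_eq_zero.1 hroot with h | h
    · have h1 : a = μ := by linarith
      have h2 : d = ν := by linarith
      subst h1 h2
      have : d - a ≠ 0 := sub_ne_zero.2 hne.symm
      refine ⟨⟨!![1, b / (d - a); 0, 1], by simp [Matrix.det_fin_two]⟩, ?_⟩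
      ext i j
      fin_cases i <;> fin_cases j <;> simp [Matrix.mul_apply, Fin.sum_univ_two]
      field_simp
      ring
    · have h1 : a = ν := by linarith
      have h2 : d = μ := by linarith
      subst h1 h2
      refine ⟨⟨!![b / (d - a), -1; 1, 0], by simp [Matrix.det_fin_two]⟩, ?_⟩
      ext i j
      fin_cases i <;> fin_cases j <;> simp [Matrix.mul_apply, Fin.sum_univ_two]
      field_simp
      ring
  · refine ⟨⟨!![μ - d, (ν - d) / (c * (μ - ν)); c, 1 / (μ - ν)], ?_⟩, ?_⟩
    · rw [Matrix.det_fin_two]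
      simp
      field_simp
      ring
    · have e1 : a = μ + ν - d := by linarith
      subst e1
      have e2 : b * c = (μ + ν - d) * d - μ * ν := by linarith
      ext i j
      fin_cases i <;> fin_cases j <;> simp [Matrix.mul_apply, Fin.sum_univ_two]
      · linear_combination e2
      · field_simp
        linear_combination e2
      · ring
      · field_simp
        ring

/-- Every hyperbolic element `B` translates a geodesic along itself, by its translation length:
after conjugation the geodesic is the imaginary half-axis. -/
theorem exists_axis (B : SL(2, ℝ)) (hB : 2 < |B.val.trace|) :
    ∃ γ : ℝ → UpperHalfPlane, Isometry γ ∧ ∀ t, B • γ t = γ (t + translationLength B) := by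
  set r := Real.arcosh (|B.val.trace| / 2) with hr
  have hr0 : 0 < r := Real.arcosh_pos (by linarith)
  have hcosh : Real.exp r + Real.exp (-r) = |B.val.trace| := by
    have := Real.cosh_arcosh (x := |B.val.trace| / 2) (by linarith)
    rw [← hr, Real.cosh_eq] at this
    linarith
  have hexp : Real.exp r * Real.exp (-r) = 1 := by rw [← Real.exp_add]; simp
  have hlt : Real.exp (-r) < Real.exp r := Real.exp_lt_exp.2 (by linarith)
  -- the sign of the trace is the sign of both eigenvalues
  obtain ⟨ε, hε, htr⟩ : ∃ ε : ℝ, ε * ε = 1 ∧ B.val.trace = ε * |B.val.trace| := by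
    rcases abs_cases B.val.trace with h | h
    · exact ⟨1, by norm_num, by linarith [h.1]⟩
    · exact ⟨-1, by norm_num, by linarith [h.1]⟩
  have hε0 : ε ≠ 0 := by rintro rfl; simp at hε
  have hdet : ε * Real.exp r * (ε * Real.exp (-r)) = 1 := by
    linear_combination hexp + Real.exp r * Real.exp (-r) * hε
  obtain ⟨P, hP⟩ := exists_mul_eq_mul_diagonal B (μ := ε * Real.exp r) (ν := ε * Real.exp (-r))
    hdet (fun h => hlt.ne' (mul_left_cancel₀ hε0 h)) (by rw [htr, ← hcosh]; ring)
  let D : SL(2, ℝ) :=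
    ⟨!![ε * Real.exp r, 0; 0, ε * Real.exp (-r)], by simpa [Matrix.det_fin_two] using hdet⟩
  have hBP : B * P = P * D := Subtype.ext hP
  refine ⟨fun t => P • UpperHalfPlane.mk ⟨0, Real.exp t⟩ (Real.exp_pos t),
    (isometry_smul _ P).comp (UpperHalfPlane.isometry_vertical_line 0), fun t => ?_⟩
  rw [← mul_smul, hBP, mul_smul]
  congr 1
  apply UpperHalfPlane.ext
  rw [UpperHalfPlane.coe_specialLinearGroup_apply]
  have hl : translationLength B = r + r := by rw [translationLength, ← hr]; ring
  have hν : ((ε * Real.exp (-r) : ℝ) : ℂ) ≠ 0 := by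
    exact_mod_cast mul_ne_zero hε0 (Real.exp_pos _).ne'
  have hmul : Real.exp (t + translationLength B) * (ε * Real.exp (-r))
      = ε * Real.exp r * Real.exp t := by
    rw [hl, Real.exp_add, Real.exp_add]
    linear_combination Real.exp t * Real.exp r * ε * hexp
  have key : ((ε * Real.exp r : ℝ) : ℂ) * (⟨0, Real.exp t⟩ : ℂ) =
      (⟨0, Real.exp (t + translationLength B)⟩ : ℂ) * ((ε * Real.exp (-r) : ℝ) : ℂ) := by
    apply Complex.ext
    · simp [-Complex.ofReal_mul]
    · simp only [Complex.mul_im, Complex.ofReal_re, Complex.ofReal_im]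
      linarith
  simp only [D, Algebra.algebraMap_self, Matrix.of_apply, Matrix.cons_val', Matrix.cons_val_zero,
    Matrix.cons_val_one, Matrix.cons_val_fin_one, RingHom.id_apply, map_zero,
    Complex.ofReal_zero, add_zero, zero_mul, zero_add]
  rw [div_eq_iff hν]
  exact key

/-- Natural multiples of translation lengths of hyperbolic elements belong to the length spectrum,
since powers of an element translate along the same axis. -/
theorem mul_translationLength_mem {Γ : Subgroup SL(2, ℝ)} {B : SL(2, ℝ)} (hB : B ∈ Γ)
    (htr : 2 < |B.val.trace|) {q : ℕ} (hq : 0 < q) :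
    (q : ℝ) * translationLength B ∈ lengthSpectrum Γ := by
  obtain ⟨γ, hγ, h⟩ := exists_axis B htr
  refine ⟨mul_pos (Nat.cast_pos.2 hq) (translationLength_pos htr), γ, hγ, B ^ q,
    Γ.pow_mem hB q, fun t => ?_⟩
  clear hq
  induction q with
  | zero => simp
  | succ k ih => rw [pow_succ', mul_smul, ih, h]; push_cast; ring_nf

/-! ### Trace identities -/

/-- The trace of a commutator measures how far two matrices are from commuting. -/
theorem trace_commutator (X Y : SL(2, ℝ)) :
    (⁅X, Y⁆).val.trace = 2 - (X.val * Y.val - Y.val * X.val).det := by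
  have hX := X.det_coe
  have hY := Y.det_coe
  rw [Matrix.det_fin_two] at hX hY
  simp only [commutatorElement_def, Matrix.SpecialLinearGroup.coe_mul,
    Matrix.SpecialLinearGroup.coe_inv, Matrix.adjugate_fin_two, Matrix.det_fin_two,
    Matrix.trace_fin_two, Matrix.mul_apply, Fin.sum_univ_two, Matrix.sub_apply, Matrix.of_apply,
    Matrix.cons_val', Matrix.cons_val_zero, Matrix.cons_val_one, Matrix.cons_val_fin_one]
  linear_combination 2 * (Y.val 0 0 * Y.val 1 1 - Y.val 0 1 * Y.val 1 0) * hX + 2 * hY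

theorem trace_commutator_comm (X Y : SL(2, ℝ)) :
    (⁅Y, X⁆).val.trace = (⁅X, Y⁆).val.trace := by
  have : Y.val * X.val - X.val * Y.val = -(X.val * Y.val - Y.val * X.val) := (neg_sub _ _).symm
  rw [trace_commutator, trace_commutator, this, Matrix.det_neg]
  simp

/-- Fricke's identity. -/
theorem trace_commutator_eq (X Y : SL(2, ℝ)) :
    (⁅X, Y⁆).val.trace = X.val.trace ^ 2 + Y.val.trace ^ 2 + (X.val * Y.val).trace ^ 2
      - X.val.trace * Y.val.trace * (X.val * Y.val).trace - 2 := by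
  rw [trace_commutator]
  have hX := X.det_coe
  have hY := Y.det_coe
  rw [Matrix.det_fin_two] at hX hY
  simp only [Matrix.det_fin_two, Matrix.trace_fin_two, Matrix.mul_apply, Fin.sum_univ_two,
    Matrix.sub_apply]
  generalize X.val 0 0 = a at *
  generalize X.val 0 1 = b at *
  generalize X.val 1 0 = c at *
  generalize X.val 1 1 = d at *
  generalize Y.val 0 0 = e at *
  generalize Y.val 0 1 = f at *
  generalize Y.val 1 0 = k at *
  generalize Y.val 1 1 = l at *
  -- the homogeneous form of the identity, with the determinants of both matrices restored
  have h : 4 * (a * d - b * c) * (e * l - f * k)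
      - ((a * e + b * k - (e * a + f * c)) * (c * f + d * l - (k * b + l * d))
        - (a * f + b * l - (e * b + f * d)) * (c * e + d * k - (k * a + l * c)))
      = (a + d) ^ 2 * (e * l - f * k) + (e + l) ^ 2 * (a * d - b * c)
        + (a * e + b * k + (c * f + d * l)) ^ 2
        - (a + d) * (e + l) * (a * e + b * k + (c * f + d * l)) := by ring
  rw [hX, hY] at h
  linarith

theorem trace_commutator_of_eq_add_smul {X E : SL(2, ℝ)} {a b : ℝ}
    (h : X.val = a • (1 : Matrix (Fin 2) (Fin 2) ℝ) + b • E.val) (Y : SL(2, ℝ)) :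
    (⁅X, Y⁆).val.trace = 2 + b ^ 2 * ((⁅E, Y⁆).val.trace - 2) := by
  have : X.val * Y.val - Y.val * X.val = b • (E.val * Y.val - Y.val * E.val) := by
    rw [h]; simp [add_mul, mul_add, smul_sub]
  rw [trace_commutator, trace_commutator, this, Matrix.det_smul, Fintype.card_fin]
  ring

/-- The Cayley–Hamilton identity in `SL₂(ℝ)`. -/
theorem sl_mul_self (X : SL(2, ℝ)) :
    X.val * X.val = (-1 : ℝ) • (1 : Matrix (Fin 2) (Fin 2) ℝ) + X.val.trace • X.val := by
  have hX := X.det_coe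
  rw [Matrix.det_fin_two] at hX
  ext i j
  fin_cases i <;> fin_cases j <;>
    simp [Matrix.mul_apply, Fin.sum_univ_two, Matrix.trace_fin_two] <;>
    first | linear_combination -hX | ring

theorem trace_commutator_sq (X Y : SL(2, ℝ)) :
    (⁅X * X, Y⁆).val.trace = 2 + X.val.trace ^ 2 * ((⁅X, Y⁆).val.trace - 2) :=
  trace_commutator_of_eq_add_smul (sl_mul_self X) Y

/-- Over the reals, two elements with `tr ⁅X, Y⁆ ≤ 2`, one of which is hyperbolic, have a real
common eigenvector or are both hyperbolic, so the other one is not elliptic. -/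
theorem two_le_abs_trace_of_hyperbolic {X Y : SL(2, ℝ)} (hX : 2 < |X.val.trace|)
    (h : (⁅X, Y⁆).val.trace ≤ 2) : 2 ≤ |Y.val.trace| := by
  rw [trace_commutator_eq] at h
  have hx : 4 < X.val.trace ^ 2 := by
    rw [← sq_abs]; nlinarith
  by_contra! hY
  have hy : Y.val.trace ^ 2 < 4 := by
    rw [← sq_abs]; nlinarith [abs_nonneg Y.val.trace]
  nlinarith [sq_nonneg (2 * (X.val * Y.val).trace - X.val.trace * Y.val.trace),
    mul_pos (sub_pos.2 hx) (sub_pos.2 hy)]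

theorem entry_ne_zero_of_elliptic {X : SL(2, ℝ)} (hX : |X.val.trace| < 2) : X.val 1 0 ≠ 0 := by
  intro h
  have hd := X.det_coe
  rw [Matrix.det_fin_two, h] at hd
  rw [Matrix.trace_fin_two, abs_lt] at hX
  nlinarith [sq_nonneg (X.val 0 0 - X.val 1 1)]

/-- The commutator of an elliptic element with an element not commuting with it is hyperbolic
of positive trace. -/
theorem two_lt_trace_commutator_of_elliptic {X Y : SL(2, ℝ)} (hX : |X.val.trace| < 2)
    (h : ¬ Commute X Y) : 2 < (⁅X, Y⁆).val.trace := by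
  have hr := entry_ne_zero_of_elliptic hX
  have hd := X.det_coe
  rw [Matrix.det_fin_two] at hd
  rw [Matrix.trace_fin_two] at hX
  rw [trace_commutator]
  obtain ⟨L, hL⟩ : ∃ L, L = X.val * Y.val - Y.val * X.val := ⟨_, rfl⟩
  rw [← hL]
  have hne : L ≠ 0 := fun h0 => h (Subtype.ext (sub_eq_zero.1 (hL.symm.trans h0)))
  have htr : L 1 1 = - L 0 0 := by
    rw [hL]; simp [Matrix.mul_apply, Fin.sum_univ_two]; ring
  have horth : L 0 0 * (X.val 0 0 - X.val 1 1) + L 0 1 * X.val 1 0 + L 1 0 * X.val 0 1 = 0 := by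
    rw [hL]; simp [Matrix.mul_apply, Fin.sum_univ_two]; ring
  have hdisc : (X.val 0 0 + X.val 1 1) ^ 2 < 4 := by
    rw [← sq_abs]; nlinarith [abs_nonneg (X.val 0 0 + X.val 1 1)]
  have hdisc' : 0 < 4 - (X.val 0 0 + X.val 1 1) ^ 2 := by linarith
  rw [Matrix.det_fin_two, htr]
  -- completing the square in the quadratic form `-det` on the orthogonal complement of `X`
  have key : 4 * X.val 1 0 ^ 2 * (L 0 0 ^ 2 + L 0 1 * L 1 0) =
      (2 * X.val 1 0 * L 0 0 - L 1 0 * (X.val 0 0 - X.val 1 1)) ^ 2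
        + L 1 0 ^ 2 * (4 - (X.val 0 0 + X.val 1 1) ^ 2) := by
    linear_combination 4 * X.val 1 0 * L 1 0 * horth + 4 * L 1 0 ^ 2 * hd
  have hpos : 0 < (2 * X.val 1 0 * L 0 0 - L 1 0 * (X.val 0 0 - X.val 1 1)) ^ 2
        + L 1 0 ^ 2 * (4 - (X.val 0 0 + X.val 1 1) ^ 2) := by
    by_cases h1 : L 1 0 = 0
    · by_cases h0 : L 0 0 = 0
      · exfalso
        have h2 : L 0 1 = 0 := by simpa [h0, h1, hr] using horth
        apply hne
        ext i j
        fin_cases i <;> fin_cases j <;> simp [h0, h1, h2, htr]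
      · have := mul_ne_zero hr h0
        simp only [h1, zero_mul, sub_zero]
        positivity
    · positivity
  rw [← key] at hpos
  have : 0 < L 0 0 ^ 2 + L 0 1 * L 1 0 := by
    by_contra! hcon
    nlinarith [sq_nonneg (X.val 1 0)]
  nlinarith

/-- Elements commuting with a noncentral `E` are linear polynomials in `E`. -/
theorem exists_eq_add_smul_of_commute {E X : SL(2, ℝ)} (h : Commute E X)
    (hE : ¬ (E.val 1 0 = 0 ∧ E.val 0 1 = 0 ∧ E.val 0 0 = E.val 1 1)) :
    ∃ a b : ℝ, X.val = a • (1 : Matrix (Fin 2) (Fin 2) ℝ) + b • E.val := by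
  have hv : E.val * X.val = X.val * E.val := congrArg Subtype.val h
  have h00 := congrFun (congrFun hv 0) 0
  have h01 := congrFun (congrFun hv 0) 1
  have h10 := congrFun (congrFun hv 1) 0
  simp only [Matrix.mul_apply, Fin.sum_univ_two] at h00 h01 h10
  obtain ⟨b, hb1, hb2, hb3⟩ : ∃ b : ℝ, X.val 1 0 = b * E.val 1 0 ∧ X.val 0 1 = b * E.val 0 1 ∧
      X.val 0 0 - X.val 1 1 = b * (E.val 0 0 - E.val 1 1) := by
    by_cases h1 : E.val 1 0 = 0
    · by_cases h2 : E.val 0 1 = 0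
      · have h3 : E.val 0 0 - E.val 1 1 ≠ 0 := fun h3 => hE ⟨h1, h2, sub_eq_zero.1 h3⟩
        refine ⟨(X.val 0 0 - X.val 1 1) / (E.val 0 0 - E.val 1 1), ?_, ?_, ?_⟩ <;>
          field_simp <;> simp only [h1, h2, mul_zero, zero_mul] at * <;> linarith
      · refine ⟨X.val 0 1 / E.val 0 1, ?_, ?_, ?_⟩ <;> field_simp <;> linarith
    · refine ⟨X.val 1 0 / E.val 1 0, ?_, ?_, ?_⟩ <;> field_simp <;> linarith
  refine ⟨X.val 1 1 - b * E.val 1 1, b, ?_⟩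
  ext i j
  fin_cases i <;> fin_cases j <;> simp <;> linarith

/-- Two parabolic or central elements with `tr ⁅X, Y⁆ ≤ 2` commute: their traceless parts are
orthogonal null vectors of a quadratic form of signature `(2, 1)`. -/
theorem commute_of_parabolic {X Y : SL(2, ℝ)} (hX : |X.val.trace| = 2) (hY : |Y.val.trace| = 2)
    (h : (⁅X, Y⁆).val.trace ≤ 2) : Commute X Y := by
  rw [trace_commutator_eq] at h
  have hx : X.val.trace ^ 2 = 4 := by rw [← sq_abs, hX]; norm_num
  have hy : Y.val.trace ^ 2 = 4 := by rw [← sq_abs, hY]; norm_num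
  have hz : 2 * (X.val * Y.val).trace - X.val.trace * Y.val.trace = 0 := by
    have h4 : (2 * (X.val * Y.val).trace - X.val.trace * Y.val.trace) ^ 2 ≤ 0 := by
      have : (X.val.trace * Y.val.trace) ^ 2 = 16 := by rw [mul_pow, hx, hy]; norm_num
      nlinarith
    exact pow_eq_zero_iff two_ne_zero |>.1 (le_antisymm h4 (sq_nonneg _))
  have hdX := X.det_coe
  have hdY := Y.det_coe
  rw [Matrix.det_fin_two] at hdX hdY
  simp only [Matrix.trace_fin_two, Matrix.mul_apply, Fin.sum_univ_two] at hx hy hz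
  apply Subtype.ext
  change X.val * Y.val = Y.val * X.val
  generalize X.val = M at *
  generalize Y.val = N at *
  have hm : (M 0 0 - M 1 1) ^ 2 = -4 * (M 0 1 * M 1 0) := by linear_combination hx - 4 * hdX
  have hn : (N 0 0 - N 1 1) ^ 2 = -4 * (N 0 1 * N 1 0) := by linear_combination hy - 4 * hdY
  have ho : (M 0 0 - M 1 1) * (N 0 0 - N 1 1) + 2 * (M 0 1 * N 1 0 + M 1 0 * N 0 1) = 0 := by
    linear_combination hz
  have e1 : (M 0 0 - M 1 1) * N 1 0 - (N 0 0 - N 1 1) * M 1 0 = 0 := by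
    apply pow_eq_zero_iff two_ne_zero |>.1
    linear_combination N 1 0 ^ 2 * hm + M 1 0 ^ 2 * hn - 2 * N 1 0 * M 1 0 * ho
  have e2 : (M 0 0 - M 1 1) * N 0 1 - (N 0 0 - N 1 1) * M 0 1 = 0 := by
    apply pow_eq_zero_iff two_ne_zero |>.1
    linear_combination N 0 1 ^ 2 * hm + M 0 1 ^ 2 * hn - 2 * N 0 1 * M 0 1 * ho
  have e3 : M 0 1 * N 1 0 - M 1 0 * N 0 1 = 0 := by
    apply pow_eq_zero_iff two_ne_zero |>.1
    have h5 : 4 * (M 0 1 * N 1 0 + M 1 0 * N 0 1) ^ 2 =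
        (M 0 0 - M 1 1) ^ 2 * (N 0 0 - N 1 1) ^ 2 := by
      linear_combination
        (2 * (M 0 1 * N 1 0 + M 1 0 * N 0 1) - (M 0 0 - M 1 1) * (N 0 0 - N 1 1)) * ho
    rw [hm, hn] at h5
    linear_combination h5 / 4
  ext i j
  fin_cases i <;> fin_cases j <;> simp [Matrix.mul_apply, Fin.sum_univ_two] <;> linarith

/-! ### Normalization to determinant one -/

/-- The matrix `M / √(det M)` in `SL₂(ℝ)`, for `det M > 0`; the identity otherwise. -/
noncomputable def unimodularize (M : Matrix (Fin 2) (Fin 2) ℝ) : SL(2, ℝ) :=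
  if h : 0 < M.det then
    ⟨(√M.det)⁻¹ • M, by
      rw [Matrix.det_smul, Fintype.card_fin, inv_pow, Real.sq_sqrt h.le, inv_mul_cancel₀ h.ne']⟩
  else 1

theorem unimodularize_val {M : Matrix (Fin 2) (Fin 2) ℝ} (h : 0 < M.det) :
    (unimodularize M).val = (√M.det)⁻¹ • M := by
  have : unimodularize M = _ := dif_pos h
  rw [this]

theorem unimodularize_coe (X : SL(2, ℝ)) : unimodularize X.val = X := by
  apply Subtype.ext
  rw [unimodularize_val (by simp), X.det_coe]
  simp

theorem continuousOn_unimodularize : ContinuousOn unimodularize {M | 0 < M.det} := by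
  have hind : Topology.IsInducing (fun X : SL(2, ℝ) => X.val) := Topology.IsInducing.subtypeVal
  rw [hind.continuousOn_iff]
  have : ContinuousOn (fun M : Matrix (Fin 2) (Fin 2) ℝ => (√M.det)⁻¹ • M) {M | 0 < M.det} := by
    refine ContinuousOn.smul (f := fun M : Matrix (Fin 2) (Fin 2) ℝ => (√M.det)⁻¹) (g := fun M => M)
      (ContinuousOn.inv₀ ?_ ?_) continuousOn_id
    · exact (Real.continuous_sqrt.comp continuous_id.matrix_det).continuousOn
    · exact fun M hM => (Real.sqrt_pos.2 hM).ne'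
  exact this.congr fun M hM => unimodularize_val hM

theorem commute_unimodularize {X : SL(2, ℝ)} {M : Matrix (Fin 2) (Fin 2) ℝ} (h : Commute X.val M) :
    Commute X (unimodularize M) := by
  by_cases hM : 0 < M.det
  · apply Subtype.ext
    change X.val * (unimodularize M).val = (unimodularize M).val * X.val
    rw [unimodularize_val hM]
    simp [h.eq]
  · have : unimodularize M = 1 := dif_neg hM
    rw [this]
    exact Commute.one_right X

/-- A path `s ↦ (1 + s Y) / √(1 + s tr Y + s²)` through the identity in the centralizer of `Y`. -/
noncomputable def centralizerPath (Y : SL(2, ℝ)) (s : ℝ) : SL(2, ℝ) :=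
  unimodularize (1 + s • Y.val)

theorem det_one_add_smul (Y : SL(2, ℝ)) (s : ℝ) :
    (1 + s • Y.val).det = 1 + s * Y.val.trace + s ^ 2 := by
  have := Y.det_coe
  rw [Matrix.det_fin_two] at this
  simp [Matrix.det_fin_two, Matrix.trace_fin_two]
  linear_combination s ^ 2 * this

/-- The bound on the time for which the formula for `centralizerPath` is used. -/
noncomputable def centralizerTime (Y : SL(2, ℝ)) : ℝ := (1 + |Y.val.trace|)⁻¹

theorem centralizerTime_pos (Y : SL(2, ℝ)) : 0 < centralizerTime Y := by
  unfold centralizerTime; positivity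

theorem det_pos_of_mem {Y : SL(2, ℝ)} {s : ℝ} (hs : s ∈ Set.Icc 0 (centralizerTime Y)) :
    0 < 1 + s * Y.val.trace + s ^ 2 := by
  have h1 : s * (1 + |Y.val.trace|) ≤ 1 := by
    have := hs.2
    rw [centralizerTime, ← one_div, le_div_iff₀ (by positivity)] at this
    exact this
  rcases hs.1.eq_or_lt with h | h
  · rw [← h]; norm_num
  · nlinarith [neg_abs_le Y.val.trace]

theorem centralizerPath_val {Y : SL(2, ℝ)} {s : ℝ} (hs : s ∈ Set.Icc 0 (centralizerTime Y)) :
    (centralizerPath Y s).val =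
      (√(1 + s * Y.val.trace + s ^ 2))⁻¹ • (1 + s • Y.val) := by
  rw [centralizerPath, unimodularize_val, det_one_add_smul]
  rw [det_one_add_smul]; exact det_pos_of_mem hs

theorem continuousOn_centralizerPath (Y : SL(2, ℝ)) :
    ContinuousOn (centralizerPath Y) (Set.Icc 0 (centralizerTime Y)) := by
  apply continuousOn_unimodularize.comp
  · fun_prop
  · intro s hs
    rw [Set.mem_ofPred_eq]
    rw [det_one_add_smul]
    exact det_pos_of_mem hs

theorem centralizerPath_zero (Y : SL(2, ℝ)) : centralizerPath Y 0 = 1 := by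
  rw [centralizerPath, zero_smul, add_zero]
  exact unimodularize_coe 1

theorem commute_centralizerPath (Y : SL(2, ℝ)) (s : ℝ) : Commute Y (centralizerPath Y s) :=
  commute_unimodularize ((Commute.one_right _).add_right ((Commute.refl _).smul_right s))

theorem trace_mul_centralizerPath_sq {X Y : SL(2, ℝ)} {s : ℝ}
    (hs : s ∈ Set.Icc 0 (centralizerTime Y)) :
    (X * centralizerPath Y s).val.trace ^ 2 =
      (X.val.trace + s * (X.val * Y.val).trace) ^ 2 / (1 + s * Y.val.trace + s ^ 2) := by
  rw [Matrix.SpecialLinearGroup.coe_mul, centralizerPath_val hs]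
  have : (X.val * ((√(1 + s * Y.val.trace + s ^ 2))⁻¹ • (1 + s • Y.val))).trace =
      (√(1 + s * Y.val.trace + s ^ 2))⁻¹ * (X.val.trace + s * (X.val * Y.val).trace) := by
    simp only [Matrix.mul_smul, mul_add, mul_one, Matrix.trace_smul, Matrix.trace_add, smul_eq_mul]
  rw [this, mul_pow, inv_pow, Real.sq_sqrt (det_pos_of_mem hs).le]
  field_simp

/-- If `X = a + b E`, then `X` times the path in the centralizer of `E` is again a linear
polynomial in `E`, with explicit leading coefficient. -/
theorem exists_mul_centralizerPath_eq {X E : SL(2, ℝ)} {a b : ℝ}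
    (h : X.val = a • (1 : Matrix (Fin 2) (Fin 2) ℝ) + b • E.val) {s : ℝ}
    (hs : s ∈ Set.Icc 0 (centralizerTime E)) :
    ∃ a' b' : ℝ, b' ^ 2 = (b + s * (a + b * E.val.trace)) ^ 2 / (1 + s * E.val.trace + s ^ 2) ∧
      (X * centralizerPath E s).val = a' • (1 : Matrix (Fin 2) (Fin 2) ℝ) + b' • E.val := by
  set k := (√(1 + s * E.val.trace + s ^ 2))⁻¹ with hk
  refine ⟨k * (a - b * s), k * (b + s * (a + b * E.val.trace)), ?_, ?_⟩
  · rw [mul_pow, hk, inv_pow, Real.sq_sqrt (det_pos_of_mem hs).le]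
    field_simp
  · rw [Matrix.SpecialLinearGroup.coe_mul, centralizerPath_val hs, ← hk, h]
    have : (a • (1 : Matrix (Fin 2) (Fin 2) ℝ) + b • E.val) * (k • (1 + s • E.val)) =
        (k * a) • (1 : Matrix (Fin 2) (Fin 2) ℝ) + (k * (b + s * a)) • E.val
          + (k * b * s) • (E.val * E.val) := by
      simp only [add_mul, mul_add, smul_mul_assoc, mul_smul_comm, one_mul, mul_one, smul_smul,
        smul_add]
      module
    rw [this, sl_mul_self]
    module

/-- The functions of `s` occurring along `centralizerPath` are not constant near `0`, up to
degenerate coefficients. -/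
theorem exists_div_ne {u v y : ℝ} (h : ¬ (2 * u * v = u ^ 2 * y ∧ v ^ 2 = u ^ 2)) {δ : ℝ}
    (hδ : 0 < δ) (hpos : ∀ s ∈ Set.Icc 0 δ, 0 < 1 + s * y + s ^ 2) {ε : ℝ} (hε : 0 < ε) :
    ∃ s ∈ Set.Icc 0 δ, s ≤ ε ∧ (u + s * v) ^ 2 / (1 + s * y + s ^ 2) ≠ u ^ 2 := by
  by_contra! hcon
  -- `(u + s v)² - u² (1 + s y + s²)` is `s` times an affine function of `s`
  set r := min δ ε
  have hr : 0 < r := lt_min hδ hε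
  have key : ∀ s, 0 < s → s ≤ r → (2 * u * v - u ^ 2 * y) + s * (v ^ 2 - u ^ 2) = 0 := by
    intro s hs hsr
    have hmem : s ∈ Set.Icc 0 δ := ⟨hs.le, hsr.trans (min_le_left _ _)⟩
    have := hcon s hmem (hsr.trans (min_le_right _ _))
    rw [div_eq_iff (hpos s hmem).ne'] at this
    apply mul_left_cancel₀ hs.ne'
    linear_combination this
  have k1 := key r hr le_rfl
  have k2 := key (r / 2) (by linarith) (by linarith)
  have k3 : r * (v ^ 2 - u ^ 2) = 0 := by linarith
  have k4 : v ^ 2 - u ^ 2 = 0 := by simpa [hr.ne'] using k3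
  exact h ⟨by rw [k4] at k1; linarith, by linarith⟩

/-! ### Small gaps between multiples of translation lengths -/

/-- A map assigning continuously to each tuple an element of the subgroup it generates, such as
the evaluation of a word. -/
def IsWordMap {m : ℕ} (w : (Fin m → SL(2, ℝ)) → SL(2, ℝ)) : Prop :=
  Continuous w ∧ ∀ A, w A ∈ Subgroup.closure (Set.range A)

theorem isWordMap_apply {m : ℕ} (i : Fin m) :
    IsWordMap (Function.eval i : (Fin m → SL(2, ℝ)) → SL(2, ℝ)) :=
  ⟨continuous_apply i, fun _ => Subgroup.subset_closure ⟨i, rfl⟩⟩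

theorem IsWordMap.mul {m : ℕ} {v w : (Fin m → SL(2, ℝ)) → SL(2, ℝ)} (hv : IsWordMap v)
    (hw : IsWordMap w) : IsWordMap fun A => v A * w A :=
  ⟨hv.1.mul hw.1, fun A => mul_mem (hv.2 A) (hw.2 A)⟩

theorem IsWordMap.commutator {m : ℕ} {v w : (Fin m → SL(2, ℝ)) → SL(2, ℝ)} (hv : IsWordMap v)
    (hw : IsWordMap w) : IsWordMap fun A => ⁅v A, w A⁆ :=
  ⟨((hv.1.mul hw.1).mul hv.1.inv).mul hw.1.inv, fun A =>
    mul_mem (mul_mem (mul_mem (hv.2 A) (hw.2 A)) (inv_mem (hv.2 A))) (inv_mem (hw.2 A))⟩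

/-- The tuples for which some multiples of the translation lengths of two hyperbolic words are
distinct, but closer than `exp (-n max) / (n + 1)`. -/
def smallGapTuples (m n : ℕ) : Set (Fin m → SL(2, ℝ)) :=
  {A | ∃ v w : (Fin m → SL(2, ℝ)) → SL(2, ℝ), IsWordMap v ∧ IsWordMap w ∧
    ∃ p q : ℕ, 0 < p ∧ 0 < q ∧ 2 < |(v A).val.trace| ∧ 2 < |(w A).val.trace| ∧
      p * translationLength (v A) ≠ q * translationLength (w A) ∧
      |p * translationLength (v A) - q * translationLength (w A)| <
        Real.exp (-n * max (p * translationLength (v A)) (q * translationLength (w A))) / (n + 1)}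

theorem continuous_trace_coe : Continuous fun B : SL(2, ℝ) => B.val.trace :=
  (continuous_induced_dom : Continuous fun B : SL(2, ℝ) => B.val).matrix_trace

theorem continuousAt_translationLength {B : SL(2, ℝ)} (hB : 2 < |B.val.trace|) :
    ContinuousAt translationLength B := by
  have h1 : ContinuousAt (fun B : SL(2, ℝ) => |B.val.trace| / 2) B :=
    (continuous_trace_coe.abs.div_const 2).continuousAt
  have h2 : ContinuousAt Real.arcosh (|B.val.trace| / 2) :=
    (Real.differentiableAt_arcosh (by rw [Set.mem_Ioi]; linarith)).continuousAt
  exact continuousAt_const.mul (ContinuousAt.comp (f := fun B : SL(2, ℝ) => |B.val.trace| / 2) h2 h1)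

theorem isOpen_smallGapTuples (m n : ℕ) : IsOpen (smallGapTuples m n) := by
  rw [isOpen_iff_mem_nhds]
  rintro A ⟨v, w, hv, hw, p, q, hp, hq, hv2, hw2, hne, hlt⟩
  have cv : ContinuousAt (fun A => (p : ℝ) * translationLength (v A)) A :=
    continuousAt_const.mul
      (ContinuousAt.comp (f := v) (continuousAt_translationLength hv2) hv.1.continuousAt)
  have cw : ContinuousAt (fun A => (q : ℝ) * translationLength (w A)) A :=
    continuousAt_const.mul
      (ContinuousAt.comp (f := w) (continuousAt_translationLength hw2) hw.1.continuousAt)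
  have tv : ContinuousAt (fun A => |(v A).val.trace|) A :=
    ((continuous_trace_coe.comp hv.1).abs).continuousAt
  have tw : ContinuousAt (fun A => |(w A).val.trace|) A :=
    ((continuous_trace_coe.comp hw.1).abs).continuousAt
  have cgap : ContinuousAt (fun A => Real.exp (-n * max (p * translationLength (v A))
      (q * translationLength (w A))) / ((n : ℝ) + 1)) A :=
    ((Real.continuous_exp.continuousAt.comp
      (continuousAt_const.mul (cv.max cw))).div_const _)
  filter_upwards [continuousAt_const.eventually_lt tv hv2, continuousAt_const.eventually_lt tw hw2,
    (cv.sub cw).eventually_ne (sub_ne_zero.2 hne), (cv.sub cw).abs.eventually_lt cgap hlt]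
    with A' h1 h2 h3 h4
  exact ⟨v, w, hv, hw, p, q, hp, hq, h1, h2, sub_ne_zero.1 h3, h4⟩

/-- A tuple with small gaps at every scale is not exponentially separated. -/
theorem not_exponentiallySeparated {m : ℕ} {A : Fin m → SL(2, ℝ)}
    (hA : ∀ n, A ∈ smallGapTuples m n) :
    ¬ ExponentiallySeparated (lengthSpectrum (Subgroup.closure (Set.range A))) := by
  rintro ⟨C, hC, β, -, h⟩
  obtain ⟨n, hn⟩ := exists_nat_gt (max C⁻¹ β)
  obtain ⟨v, w, hv, hw, p, q, hp, hq, hv2, hw2, hne, hlt⟩ := hA n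
  have hpos : 0 < (p : ℝ) * translationLength (v A) :=
    mul_pos (Nat.cast_pos.2 hp) (translationLength_pos hv2)
  have := h _ (mul_translationLength_mem (hv.2 A) hv2 hp) _
    (mul_translationLength_mem (hw.2 A) hw2 hq) hne
  rw [abs_sub_comm] at this
  set M := max (p * translationLength (v A)) (q * translationLength (w A))
  have hM : 0 < M := lt_of_lt_of_le hpos (le_max_left _ _)
  have hnC : C⁻¹ < n := (le_max_left _ _).trans_lt hn
  have hnβ : β < n := (le_max_right _ _).trans_lt hn
  have hn0 : (0 : ℝ) < n := (inv_pos.2 hC).trans hnC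
  have h1 : Real.exp (-n * M) ≤ Real.exp (-β * M) := by
    apply Real.exp_le_exp.2
    nlinarith
  have h2 : Real.exp (-n * M) / (n + 1) ≤ C * Real.exp (-n * M) := by
    rw [div_le_iff₀ (by positivity)]
    have : 1 ≤ C * (n + 1) := by
      have := mul_lt_mul_of_pos_left hnC hC
      rw [mul_inv_cancel₀ hC.ne'] at this
      linarith
    nlinarith [Real.exp_pos (-n * M)]
  have h3 := mul_le_mul_of_nonneg_left h1 hC.le
  linarith

/-- If along a path in `G` starting at `A` one word keeps a constant hyperbolic trace while the
trace of another one varies arbitrarily near the start, then the ratio of their translation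
lengths takes a rational value, and the corresponding multiples have arbitrarily small nonzero
gaps. -/
theorem mem_closure_of_path {m : ℕ} {G : Set (Fin m → SL(2, ℝ))} {A : Fin m → SL(2, ℝ)}
    {a : ℝ → Fin m → SL(2, ℝ)} {δ : ℝ} (ha : ContinuousOn a (Set.Icc 0 δ)) (h0 : a 0 = A)
    (hG : ∀ s ∈ Set.Icc 0 δ, a s ∈ G) {v w : (Fin m → SL(2, ℝ)) → SL(2, ℝ)} (hv : IsWordMap v)
    (hw : IsWordMap w) {c : ℝ} (hc : 2 < c)
    (hvc : ∀ s ∈ Set.Icc 0 δ, |(v (a s)).val.trace| = c)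
    (hw2 : ∀ s ∈ Set.Icc 0 δ, 2 ≤ |(w (a s)).val.trace|)
    (hne : ∀ ε > 0, ∃ s ∈ Set.Icc 0 δ, s ≤ ε ∧
      |(w (a s)).val.trace| ≠ |(w (a 0)).val.trace|) (n : ℕ) :
    A ∈ closure (G ∩ smallGapTuples m n) := by
  rw [mem_closure_iff_nhds]
  intro t ht
  have hδ : (0 : ℝ) ∈ Set.Icc 0 δ := by
    obtain ⟨s, hs, -⟩ := hne 1 one_pos
    exact ⟨le_rfl, hs.1.trans hs.2⟩
  rw [← h0] at ht
  obtain ⟨ε, hε, hεt⟩ := Metric.mem_nhdsWithin_iff.1 (ha 0 hδ ht)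
  obtain ⟨s₀, hs₀, hsε, hτ⟩ := hne (ε / 2) (by linarith)
  have hsub : ∀ s ∈ Set.Icc 0 s₀, s ∈ Set.Icc 0 δ := fun s hs => ⟨hs.1, hs.2.trans hs₀.2⟩
  have hmem : ∀ s ∈ Set.Icc 0 s₀, a s ∈ t := by
    intro s hs
    refine hεt ⟨?_, hsub s hs⟩
    rw [Metric.mem_ball, Real.dist_eq, sub_zero, abs_of_nonneg hs.1]
    linarith [hs.2]
  set φ : ℝ → ℝ := fun s => translationLength (w (a s)) with hφ
  have hφc : ContinuousOn φ (Set.uIcc 0 s₀) := by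
    rw [Set.uIcc_of_le hs₀.1]
    have h1 : ContinuousOn (fun s => |(w (a s)).val.trace| / 2) (Set.Icc 0 s₀) :=
      ((continuous_trace_coe.comp hw.1).abs.div_const 2).comp_continuousOn (ha.mono hsub)
    refine continuousOn_const.mul (Real.continuousOn_arcosh.comp h1 fun s hs => ?_)
    rw [Set.mem_Ici]
    linarith [hw2 s (hsub s hs)]
  have hφne : φ 0 ≠ φ s₀ := by
    intro h
    have := Real.arcosh_injOn (x₁ := |(w (a 0)).val.trace| / 2)
      (by rw [Set.mem_Ici]; linarith [hw2 0 hδ])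
      (by rw [Set.mem_Ici]; linarith [hw2 s₀ hs₀]) (mul_left_cancel₀ two_ne_zero h)
    exact hτ (by linarith)
  have hφ0 : ∀ s ∈ Set.Icc 0 δ, 0 ≤ φ s := fun s hs =>
    mul_nonneg two_pos.le (Real.arcosh_nonneg (by linarith [hw2 s hs]))
  have hlohi : min (φ 0) (φ s₀) < max (φ 0) (φ s₀) := min_lt_max.2 hφne
  have hlo : 0 ≤ min (φ 0) (φ s₀) := le_min (hφ0 0 hδ) (hφ0 s₀ hs₀)
  have hivt := intermediate_value_uIcc hφc
  rw [Set.uIcc_of_le hs₀.1] at hivt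
  set L := 2 * Real.arcosh (c / 2) with hLdef
  have hL : 0 < L := mul_pos two_pos (Real.arcosh_pos (by linarith))
  obtain ⟨r, hr1, hr2⟩ := exists_rat_btwn ((div_lt_div_iff_of_pos_right hL).2 hlohi)
  rw [div_lt_iff₀ hL] at hr1
  rw [lt_div_iff₀ hL] at hr2
  have hr0 : 0 < r := by
    have : 0 < (r : ℝ) * L := hlo.trans_lt hr1
    exact_mod_cast (pos_iff_pos_of_mul_pos this).2 hL
  obtain ⟨p, hp⟩ : ∃ p : ℕ, (p : ℤ) = r.num := ⟨r.num.toNat, Int.toNat_of_nonneg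
    (Rat.num_pos.2 hr0).le⟩
  have hp0 : 0 < p := by
    have := Rat.num_pos.2 hr0
    omega
  have hq0 : (0 : ℝ) < r.den := Nat.cast_pos.2 r.den_pos
  have hpq : (r : ℝ) * r.den = p := by
    have : r * r.den = r.num := Rat.mul_den_eq_num r
    rw [← hp] at this
    exact_mod_cast this
  -- the length of the second word is moved to `r L + η / q` with `η` small
  set K := Real.exp (-n * (p * L + 1)) / ((n : ℝ) + 1) with hK
  have hK0 : 0 < K := by positivity
  set η := min ((max (φ 0) (φ s₀) - r * L) * r.den) (min 1 (K / 2)) with hη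
  have hη0 : 0 < η := lt_min (mul_pos (sub_pos.2 hr2) hq0) (lt_min one_pos (by linarith))
  have hη1 : η ≤ 1 := (min_le_right _ _).trans (min_le_left _ _)
  have hηK : η < K := ((min_le_right _ _).trans (min_le_right _ _)).trans_lt (by linarith)
  have hηhi : η / r.den ≤ max (φ 0) (φ s₀) - r * L := by
    rw [div_le_iff₀ hq0]
    exact min_le_left _ _
  have hηq : 0 < η / r.den := div_pos hη0 hq0
  obtain ⟨s, hs, hsv⟩ := hivt (show r * L + η / r.den ∈ _ from ⟨by linarith, by linarith⟩)
  have hvs : translationLength (v (a s)) = L := by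
    rw [translationLength, hvc s (hsub s hs)]
  have hws : translationLength (w (a s)) = r * L + η / r.den := hsv
  have hqw : (r.den : ℝ) * translationLength (w (a s)) = p * L + η := by
    rw [hws, ← hpq]
    field_simp
  refine ⟨a s, hmem s hs, hG s (hsub s hs), v, w, hv, hw, p, r.den, hp0, r.den_pos, ?_, ?_, ?_, ?_⟩
  · rwa [hvc s (hsub s hs)]
  · refine (hw2 s (hsub s hs)).lt_of_ne fun h => ?_
    rw [translationLength, ← h] at hws
    have : (0 : ℝ) < r * L := hlo.trans_lt hr1
    norm_num at hws
    linarith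
  · rw [hqw, hvs]
    linarith
  · rw [hqw, hvs, max_eq_right (by linarith), sub_add_cancel_left, abs_neg, abs_of_pos hη0]
    refine hηK.trans_le ?_
    refine div_le_div_of_nonneg_right (Real.exp_le_exp.2 ?_) (by positivity)
    have : (0 : ℝ) ≤ n := n.cast_nonneg
    nlinarith

/-! ### Modifying one pair of a tuple -/

/-- The index `2i` (for `false`) or `2i + 1` (for `true`) of a member of the `i`-th pair. -/
def pairIdx {g : ℕ} (i : Fin g) (b : Bool) : Fin (2 * g) :=
  ⟨2 * i.val + b.toNat, by have := b.toNat_le; omega⟩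

theorem pairIdx_inj {g : ℕ} {i j : Fin g} {b c : Bool} :
    pairIdx i b = pairIdx j c ↔ i = j ∧ b = c := by
  refine ⟨fun h => ?_, by rintro ⟨rfl, rfl⟩; rfl⟩
  have h' : 2 * i.val + b.toNat = 2 * j.val + c.toNat := congrArg Fin.val h
  have hb := b.toNat_le
  have hc := c.toNat_le
  refine ⟨Fin.ext (by omega), ?_⟩
  cases b <;> cases c <;> simp_all <;> omega

/-- The tuple `A` with the `b`-member of its `i`-th pair replaced by `X` and the other member of
this pair by `Y`. -/
def setPair {g : ℕ} (A : Fin (2 * g) → SL(2, ℝ)) (i : Fin g) (b : Bool) (X Y : SL(2, ℝ)) :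
    Fin (2 * g) → SL(2, ℝ) :=
  Function.update (Function.update A (pairIdx i b) X) (pairIdx i !b) Y

section setPair

variable {g : ℕ} (A : Fin (2 * g) → SL(2, ℝ)) (i : Fin g) (b : Bool) (X Y : SL(2, ℝ))

theorem setPair_self : setPair A i b X Y (pairIdx i b) = X := by
  have : pairIdx i b ≠ pairIdx i !b := by simp [Ne, pairIdx_inj]
  rw [setPair, Function.update_of_ne this, Function.update_self]

theorem setPair_partner : setPair A i b X Y (pairIdx i !b) = Y := by
  rw [setPair, Function.update_self]

theorem setPair_of_ne {j : Fin g} (h : j ≠ i) (c : Bool) :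
    setPair A i b X Y (pairIdx j c) = A (pairIdx j c) := by
  rw [setPair, Function.update_of_ne, Function.update_of_ne] <;> simp [Ne, pairIdx_inj, h]

theorem setPair_eq_self : setPair A i b (A (pairIdx i b)) (A (pairIdx i !b)) = A := by
  simp [setPair]

end setPair

theorem continuous_setPair {g : ℕ} (A : Fin (2 * g) → SL(2, ℝ)) (i : Fin g) (b : Bool) :
    Continuous fun p : SL(2, ℝ) × SL(2, ℝ) => setPair A i b p.1 p.2 := by
  have h : Continuous fun p : SL(2, ℝ) × SL(2, ℝ) => Function.update A (pairIdx i b) p.1 :=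
    continuous_const.update _ continuous_fst
  exact h.update _ continuous_snd

theorem continuousOn_setPair {g : ℕ} (A : Fin (2 * g) → SL(2, ℝ)) (i : Fin g) (b : Bool)
    {X Y : ℝ → SL(2, ℝ)} {S : Set ℝ} (hX : ContinuousOn X S) (hY : ContinuousOn Y S) :
    ContinuousOn (fun s => setPair A i b (X s) (Y s)) S :=
  (continuous_setPair A i b).comp_continuousOn (hX.prodMk hY)

theorem mem_surfaceTuples_of_commutator_eq {g : ℕ} {A A' : Fin (2 * g) → SL(2, ℝ)}
    (hA : A ∈ surfaceTuples g) (h : ∀ i : Fin g, ⁅A' (pairIdx i false), A' (pairIdx i true)⁆ =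
      ⁅A (pairIdx i false), A (pairIdx i true)⁆) : A' ∈ surfaceTuples g := by
  have hA' : (List.ofFn fun i : Fin g => ⁅A (pairIdx i false), A (pairIdx i true)⁆).prod = 1 := hA
  change (List.ofFn fun i : Fin g => ⁅A' (pairIdx i false), A' (pairIdx i true)⁆).prod = 1
  rw [funext h, hA']

theorem setPair_mem_surfaceTuples {g : ℕ} {A : Fin (2 * g) → SL(2, ℝ)}
    (hA : A ∈ surfaceTuples g) {i : Fin g} {b : Bool} {X Y : SL(2, ℝ)}
    (h : ⁅X, Y⁆ = ⁅A (pairIdx i b), A (pairIdx i !b)⁆) :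
    setPair A i b X Y ∈ surfaceTuples g := by
  refine mem_surfaceTuples_of_commutator_eq hA fun j => ?_
  by_cases hj : j = i
  · subst hj
    have h1 := setPair_self A j b X Y
    have h2 := setPair_partner A j b X Y
    cases b
    · simp only [Bool.not_false] at h1 h2 h
      rw [h1, h2, h]
    · simp only [Bool.not_true] at h1 h2 h
      rw [h1, h2, ← commutatorElement_inv, h, commutatorElement_inv]
  · rw [setPair_of_ne _ _ _ _ _ hj, setPair_of_ne _ _ _ _ _ hj]

theorem commutator_mul_of_commute {G : Type*} [Group G] {X Y Z : G} (h : Commute Y Z) :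
    ⁅X * Z, Y⁆ = ⁅X, Y⁆ := by
  have : Z * Y * Z⁻¹ = Y := by rw [← h.eq, mul_inv_cancel_right]
  calc ⁅X * Z, Y⁆ = X * (Z * Y * Z⁻¹) * X⁻¹ * Y⁻¹ := by
        simp only [commutatorElement_def, mul_inv_rev, mul_assoc]
    _ = ⁅X, Y⁆ := by rw [this, commutatorElement_def]

theorem commutator_eq_one_of_commute {G : Type*} [Group G] {X Y : G} (h : Commute X Y) :
    ⁅X, Y⁆ = 1 :=
  commutatorElement_eq_one_iff_commute.2 h

/-! ### Tuples approximated by tuples with small gaps -/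

theorem abs_two_add_ne {x y k : ℝ} (hk : 0 < k) (hx : 0 ≤ x) (hy : 0 ≤ y) (h : x ≠ y) :
    |2 + x * k| ≠ |2 + y * k| := by
  rw [abs_of_nonneg (by positivity), abs_of_nonneg (by positivity)]
  exact fun h' => h (mul_right_cancel₀ hk.ne' (add_left_cancel h'))

/-- If a pair has `tr ⁅X, Y⁆ > 2`, twisting `X` along the centralizer of `Y` fixes the hyperbolic
element `⁅X, Y⁆` and moves the trace of `⁅X², Y⁆`. -/
theorem mem_closure_of_two_lt_trace_commutator {g : ℕ} {A : Fin (2 * g) → SL(2, ℝ)}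
    (hA : A ∈ surfaceTuples g) (i : Fin g) (b : Bool)
    (hκ : 2 < (⁅A (pairIdx i b), A (pairIdx i !b)⁆).val.trace)
    (hxz : ¬ ((A (pairIdx i b)).val.trace = 0 ∧
      ((A (pairIdx i b)).val * (A (pairIdx i !b)).val).trace = 0)) (n : ℕ) :
    A ∈ closure (surfaceTuples g ∩ smallGapTuples (2 * g) n) := by
  obtain ⟨X, hX⟩ : ∃ X, X = A (pairIdx i b) := ⟨_, rfl⟩
  obtain ⟨Y, hY⟩ : ∃ Y, Y = A (pairIdx i !b) := ⟨_, rfl⟩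
  rw [← hX, ← hY] at hκ hxz
  have hcomm : ∀ s, ⁅X * centralizerPath Y s, Y⁆ = ⁅X, Y⁆ := fun s =>
    commutator_mul_of_commute (commute_centralizerPath Y s)
  have htr : ∀ s, (⁅X * centralizerPath Y s * (X * centralizerPath Y s), Y⁆).val.trace =
      2 + (X * centralizerPath Y s).val.trace ^ 2 * ((⁅X, Y⁆).val.trace - 2) := fun s => by
    rw [trace_commutator_sq, hcomm]
  have hX0 : X * centralizerPath Y 0 = X := by rw [centralizerPath_zero, mul_one]
  refine mem_closure_of_path (a := fun s => setPair A i b (X * centralizerPath Y s) Y)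
    (δ := centralizerTime Y)
    (continuousOn_setPair A i b (continuousOn_const.mul (continuousOn_centralizerPath Y))
      continuousOn_const) ?_ (fun s _ => setPair_mem_surfaceTuples hA ?_)
    ((isWordMap_apply (pairIdx i b)).commutator (isWordMap_apply (pairIdx i !b)))
    (((isWordMap_apply (pairIdx i b)).mul (isWordMap_apply (pairIdx i b))).commutator
      (isWordMap_apply (pairIdx i !b))) hκ (fun s _ => ?_) (fun s _ => ?_) (fun ε hε => ?_) n
  · simp only [hX0]
    rw [hX, hY, setPair_eq_self]
  · rw [hcomm, hX, hY]
  · simp only [Function.eval, setPair_self, setPair_partner, hcomm]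
    rw [abs_of_pos (by linarith)]
  · simp only [Function.eval, setPair_self, setPair_partner, htr]
    have := mul_nonneg (sq_nonneg (X * centralizerPath Y s).val.trace) (sub_pos.2 hκ).le
    rw [abs_of_nonneg (by linarith)]
    linarith
  · have hdeg : ¬ (2 * X.val.trace * (X.val * Y.val).trace = X.val.trace ^ 2 * Y.val.trace ∧
        (X.val * Y.val).trace ^ 2 = X.val.trace ^ 2) := by
      rintro ⟨h1, h2⟩
      by_cases hx : X.val.trace = 0
      · refine hxz ⟨hx, ?_⟩
        rw [hx] at h2
        simpa using h2
      · have hz : 2 * (X.val * Y.val).trace = X.val.trace * Y.val.trace :=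
          mul_left_cancel₀ hx (by linear_combination h1)
        have hy : Y.val.trace ^ 2 = 4 :=
          mul_left_cancel₀ (pow_ne_zero 2 hx) (by
            linear_combination 4 * h2 - (2 * (X.val * Y.val).trace + X.val.trace * Y.val.trace) * hz)
        rw [trace_commutator_eq] at hκ
        nlinarith
    obtain ⟨s, hs, hsε, hne⟩ := exists_div_ne hdeg (centralizerTime_pos Y)
      (fun s hs => det_pos_of_mem hs) hε
    refine ⟨s, hs, hsε, ?_⟩
    simp only [Function.eval, setPair_self, setPair_partner, htr]
    refine abs_two_add_ne (sub_pos.2 hκ) (sq_nonneg _) (sq_nonneg _) ?_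
    rwa [trace_mul_centralizerPath_sq hs, hX0]

/-- If a pair has `tr ⁅X, H⁆ ≤ 2` with `H` hyperbolic, twisting `X` along `H` moves the trace of
`X`, which cannot become elliptic. -/
theorem mem_closure_of_hyperbolic {g : ℕ} {A : Fin (2 * g) → SL(2, ℝ)}
    (hA : A ∈ surfaceTuples g) (i : Fin g) (b : Bool)
    (hκ : (⁅A (pairIdx i b), A (pairIdx i !b)⁆).val.trace ≤ 2)
    (hyp : 2 < |(A (pairIdx i !b)).val.trace|) (n : ℕ) :
    A ∈ closure (surfaceTuples g ∩ smallGapTuples (2 * g) n) := by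
  obtain ⟨X, hX⟩ : ∃ X, X = A (pairIdx i b) := ⟨_, rfl⟩
  obtain ⟨H, hH⟩ : ∃ H, H = A (pairIdx i !b) := ⟨_, rfl⟩
  rw [← hX, ← hH] at hκ
  rw [← hH] at hyp
  have hcomm : ∀ s, ⁅X * centralizerPath H s, H⁆ = ⁅X, H⁆ := fun s =>
    commutator_mul_of_commute (commute_centralizerPath H s)
  have h2 : ∀ s, 2 ≤ |(X * centralizerPath H s).val.trace| := fun s =>
    two_le_abs_trace_of_hyperbolic hyp (by rwa [trace_commutator_comm, hcomm])
  have hX0 : X * centralizerPath H 0 = X := by rw [centralizerPath_zero, mul_one]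
  refine mem_closure_of_path (a := fun s => setPair A i b (X * centralizerPath H s) H)
    (δ := centralizerTime H)
    (continuousOn_setPair A i b (continuousOn_const.mul (continuousOn_centralizerPath H))
      continuousOn_const) ?_ (fun s _ => setPair_mem_surfaceTuples hA ?_)
    (isWordMap_apply (pairIdx i !b)) (isWordMap_apply (pairIdx i b)) hyp
    (fun s _ => ?_) (fun s _ => ?_) (fun ε hε => ?_) n
  · simp only [hX0]
    rw [hX, hH, setPair_eq_self]
  · rw [hcomm, hX, hH]
  · simp only [Function.eval, setPair_partner]
  · simp only [Function.eval, setPair_self, h2]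
  · have hdeg : ¬ (2 * X.val.trace * (X.val * H.val).trace = X.val.trace ^ 2 * H.val.trace ∧
        (X.val * H.val).trace ^ 2 = X.val.trace ^ 2) := by
      rintro ⟨h1, h3⟩
      have hx : X.val.trace ≠ 0 := by
        have := h2 0
        rw [hX0] at this
        intro h0
        norm_num [h0] at this
      have hz : 2 * (X.val * H.val).trace = X.val.trace * H.val.trace :=
        mul_left_cancel₀ hx (by linear_combination h1)
      have hy : H.val.trace ^ 2 = 4 :=
        mul_left_cancel₀ (pow_ne_zero 2 hx) (by
          linear_combination 4 * h3 - (2 * (X.val * H.val).trace + X.val.trace * H.val.trace) * hz)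
      rw [← sq_abs] at hy
      nlinarith
    obtain ⟨s, hs, hsε, hne⟩ := exists_div_ne hdeg (centralizerTime_pos H)
      (fun s hs => det_pos_of_mem hs) hε
    refine ⟨s, hs, hsε, ?_⟩
    simp only [Function.eval, setPair_self, hX0]
    rwa [← trace_mul_centralizerPath_sq hs, Ne, sq_eq_sq_iff_abs_eq_abs] at hne

/-! ### Perturbing parabolic pairs -/

/-- The diagonal matrix with entries `exp t`, `exp (-t)`. -/
noncomputable def diagExp (t : ℝ) : SL(2, ℝ) :=
  ⟨!![Real.exp t, 0; 0, Real.exp (-t)], by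
    rw [Matrix.det_fin_two_of, ← Real.exp_add]; simp⟩

theorem continuous_diagExp : Continuous diagExp := by
  refine continuous_induced_rng.2 (continuous_matrix fun i j => ?_)
  fin_cases i <;> fin_cases j <;> simp <;> fun_prop

theorem diagExp_zero : diagExp 0 = 1 := by
  apply Subtype.ext
  ext i j
  fin_cases i <;> fin_cases j <;> simp [diagExp]

/-- A matrix of trace `±2` becomes hyperbolic when multiplied by small diagonal matrices of one
sign. -/
theorem exists_hyperbolic_mul_diagExp {X : SL(2, ℝ)} (hX : |X.val.trace| = 2) :
    ∃ σ : ℝ, ∀ s > 0, 2 < |(X * diagExp (σ * s)).val.trace| := by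
  obtain ⟨a, ha⟩ : ∃ a, a = X.val 0 0 := ⟨_, rfl⟩
  obtain ⟨d, hd⟩ : ∃ d, d = X.val 1 1 := ⟨_, rfl⟩
  rw [Matrix.trace_fin_two, ← ha, ← hd] at hX
  have htr : ∀ t, (X * diagExp t).val.trace = (a + d) * Real.cosh t + (a - d) * Real.sinh t := by
    intro t
    rw [Matrix.SpecialLinearGroup.coe_mul, Matrix.trace_fin_two, ha, hd]
    simp [diagExp, Matrix.mul_apply, Fin.sum_univ_two, Real.cosh_eq, Real.sinh_eq]
    ring
  obtain ⟨σ, hσ1, hσ⟩ : ∃ σ : ℝ, (σ = 1 ∨ σ = -1) ∧ 0 ≤ σ * ((a + d) * (a - d)) := by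
    rcases le_total 0 ((a + d) * (a - d)) with h | h
    · exact ⟨1, Or.inl rfl, by linarith⟩
    · exact ⟨-1, Or.inr rfl, by linarith⟩
  refine ⟨σ, fun s hs => ?_⟩
  rw [htr]
  have hc : 1 < Real.cosh (σ * s) := Real.one_lt_cosh.2 (by
    rcases hσ1 with rfl | rfl <;> simp [hs.ne'])
  have hs' : Real.sinh (σ * s) = σ * Real.sinh s := by rcases hσ1 with rfl | rfl <;> simp
  have hsp : 0 < Real.sinh s := Real.sinh_pos_iff.2 hs
  have had : (a + d) ^ 2 = 4 := by rw [← sq_abs, hX]; norm_num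
  rw [hs']
  apply lt_of_pow_lt_pow_left₀ 2 (abs_nonneg _)
  rw [sq_abs]
  have h1 := mul_nonneg hσ (mul_nonneg hsp.le (zero_lt_one.trans hc).le)
  have h2 : ((a + d) * Real.cosh (σ * s) + (a - d) * (σ * Real.sinh s)) ^ 2 =
      4 * Real.cosh (σ * s) ^ 2 + 2 * (σ * ((a + d) * (a - d)) * (Real.sinh s * Real.cosh (σ * s)))
        + ((a - d) * (σ * Real.sinh s)) ^ 2 := by
    linear_combination Real.cosh (σ * s) ^ 2 * had
  nlinarith [sq_nonneg ((a - d) * (σ * Real.sinh s))]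

/-- A pair of parabolic or central elements with `tr ⁅X, Y⁆ ≤ 2` is a limit of commuting pairs
with a hyperbolic member. -/
theorem mem_closure_of_parabolic {g : ℕ} {A : Fin (2 * g) → SL(2, ℝ)}
    (hA : A ∈ surfaceTuples g) (i : Fin g)
    (hκ : (⁅A (pairIdx i false), A (pairIdx i true)⁆).val.trace ≤ 2)
    (hpar : ∀ b, |(A (pairIdx i b)).val.trace| = 2) (n : ℕ) :
    A ∈ closure (surfaceTuples g ∩ smallGapTuples (2 * g) n) := by
  have hcomm : Commute (A (pairIdx i false)) (A (pairIdx i true)) :=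
    commute_of_parabolic (hpar _) (hpar _) hκ
  obtain ⟨b, α, β, hαβ⟩ : ∃ (b : Bool) (α β : ℝ), (A (pairIdx i b)).val =
      α • (1 : Matrix (Fin 2) (Fin 2) ℝ) + β • (A (pairIdx i !b)).val := by
    -- a central element is a polynomial of degree zero in its partner
    by_cases hc : (A (pairIdx i true)).val 1 0 = 0 ∧ (A (pairIdx i true)).val 0 1 = 0 ∧
        (A (pairIdx i true)).val 0 0 = (A (pairIdx i true)).val 1 1
    · refine ⟨true, (A (pairIdx i true)).val 0 0, 0, ?_⟩
      ext k l
      fin_cases k <;> fin_cases l <;> simp [hc.1, hc.2.1, hc.2.2]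
    · exact ⟨false, exists_eq_add_smul_of_commute hcomm.symm hc⟩
  obtain ⟨X, hX⟩ : ∃ X, X = A (pairIdx i b) := ⟨_, rfl⟩
  obtain ⟨E, hE⟩ : ∃ E, E = A (pairIdx i !b) := ⟨_, rfl⟩
  have hcommXE : Commute X E := by
    rw [hX, hE]
    cases b
    · exact hcomm
    · exact hcomm.symm
  rw [← hX, ← hE] at hαβ
  obtain ⟨σ, hσ⟩ := exists_hyperbolic_mul_diagExp (hE ▸ hpar (!b) : |E.val.trace| = 2)
  have hE' : Continuous fun s : ℝ => E * diagExp (σ * s) :=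
    continuous_const.mul (continuous_diagExp.comp (continuous_const.mul continuous_id))
  set M : ℝ → Matrix (Fin 2) (Fin 2) ℝ := fun s =>
    α • (1 : Matrix (Fin 2) (Fin 2) ℝ) + β • (E * diagExp (σ * s)).val with hM
  have hMc : Continuous M := by
    have : Continuous fun s : ℝ => (E * diagExp (σ * s)).val := continuous_induced_dom.comp hE'
    exact continuous_const.add (this.const_smul β)
  have hM0 : M 0 = X.val := by simp [hM, diagExp_zero, hαβ]
  have hcX : ContinuousAt (fun s => unimodularize (M s)) 0 := by
    refine ContinuousAt.comp (f := M) (g := unimodularize) ?_ hMc.continuousAt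
    have hopen : IsOpen {N : Matrix (Fin 2) (Fin 2) ℝ | 0 < N.det} :=
      isOpen_lt continuous_const continuous_id.matrix_det
    refine continuousOn_unimodularize.continuousAt (hopen.mem_nhds ?_)
    rw [Set.mem_ofPred_eq, hM0, X.det_coe]
    exact one_pos
  have hlim : Filter.Tendsto (fun s => setPair A i b (unimodularize (M s)) (E * diagExp (σ * s)))
      (nhdsWithin 0 (Set.Ioi 0)) (nhds A) := by
    have : ContinuousAt (fun s => setPair A i b (unimodularize (M s)) (E * diagExp (σ * s))) 0 :=
      (continuous_setPair A i b).continuousAt.comp (hcX.prodMk hE'.continuousAt)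
    have h0 : setPair A i b (unimodularize (M 0)) (E * diagExp (σ * 0)) = A := by
      rw [hM0, unimodularize_coe, mul_zero, diagExp_zero, mul_one, hX, hE, setPair_eq_self]
    rw [ContinuousAt, h0] at this
    exact this.mono_left nhdsWithin_le_nhds
  refine isClosed_closure.mem_of_tendsto hlim ?_
  filter_upwards [self_mem_nhdsWithin] with s hs
  have hc' : Commute (unimodularize (M s)) (E * diagExp (σ * s)) :=
    (commute_unimodularize (((Commute.one_right _).smul_right α).add_right
      ((Commute.refl _).smul_right β))).symm
  apply mem_closure_of_hyperbolic (i := i) (b := b)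
  · apply setPair_mem_surfaceTuples hA
    rw [← hX, ← hE, commutator_eq_one_of_commute hc', commutator_eq_one_of_commute hcommXE]
  · rw [setPair_self, setPair_partner, commutator_eq_one_of_commute hc']
    simp
  · rw [setPair_partner]
    exact hσ s hs

/-! ### Elliptic elements in two pairs -/

/-- If `E`, commuting with its partner `X`, and `F`, in another pair, are elliptic elements with
different fixed points, then twisting `X` along `E` fixes the hyperbolic element `⁅E, F⁆` and moves
the trace of `⁅X, F⁆`. -/
theorem mem_closure_of_elliptic_of_not_commute {g : ℕ} {A : Fin (2 * g) → SL(2, ℝ)}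
    (hA : A ∈ surfaceTuples g) {i j : Fin g} (hij : j ≠ i) (b c : Bool)
    (hell : |(A (pairIdx i b)).val.trace| < 2)
    (hcomm : Commute (A (pairIdx i b)) (A (pairIdx i !b)))
    (hEF : ¬ Commute (A (pairIdx i b)) (A (pairIdx j c))) (n : ℕ) :
    A ∈ closure (surfaceTuples g ∩ smallGapTuples (2 * g) n) := by
  have hκ := two_lt_trace_commutator_of_elliptic hell hEF
  obtain ⟨E, hE⟩ : ∃ E, E = A (pairIdx i b) := ⟨_, rfl⟩
  obtain ⟨X, hX⟩ : ∃ X, X = A (pairIdx i !b) := ⟨_, rfl⟩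
  obtain ⟨F, hF⟩ : ∃ F, F = A (pairIdx j c) := ⟨_, rfl⟩
  rw [← hE, ← hF] at hκ
  rw [← hE, ← hX] at hcomm
  rw [← hE] at hell
  obtain ⟨α, β, hαβ⟩ := exists_eq_add_smul_of_commute hcomm
    (fun h => entry_ne_zero_of_elliptic hell h.1)
  have htr : ∀ s ∈ Set.Icc 0 (centralizerTime E), (⁅X * centralizerPath E s, F⁆).val.trace =
      2 + (β + s * (α + β * E.val.trace)) ^ 2 / (1 + s * E.val.trace + s ^ 2) *
        ((⁅E, F⁆).val.trace - 2) := by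
    intro s hs
    obtain ⟨a', b', hb', h⟩ := exists_mul_centralizerPath_eq hαβ hs
    rw [trace_commutator_of_eq_add_smul h, hb']
  have hquot : ∀ s ∈ Set.Icc 0 (centralizerTime E),
      0 ≤ (β + s * (α + β * E.val.trace)) ^ 2 / (1 + s * E.val.trace + s ^ 2) := fun s hs =>
    div_nonneg (sq_nonneg _) (det_pos_of_mem hs).le
  have hX0 : X * centralizerPath E 0 = X := by rw [centralizerPath_zero, mul_one]
  refine mem_closure_of_path (a := fun s => setPair A i b E (X * centralizerPath E s))
    (δ := centralizerTime E)
    (continuousOn_setPair A i b continuousOn_const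
      (continuousOn_const.mul (continuousOn_centralizerPath E))) ?_
    (fun s _ => setPair_mem_surfaceTuples hA ?_)
    ((isWordMap_apply (pairIdx i b)).commutator (isWordMap_apply (pairIdx j c)))
    ((isWordMap_apply (pairIdx i !b)).commutator (isWordMap_apply (pairIdx j c)))
    hκ (fun s _ => ?_) (fun s hs => ?_) (fun ε hε => ?_) n
  · simp only [hX0]
    rw [hX, hE, setPair_eq_self]
  · rw [← hE, ← hX, commutator_eq_one_of_commute hcomm,
      commutator_eq_one_of_commute (hcomm.mul_right (commute_centralizerPath E s))]
  · simp only [Function.eval, setPair_self, setPair_of_ne _ _ _ _ _ hij, ← hF]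
    rw [abs_of_pos (by linarith)]
  · simp only [Function.eval, setPair_partner, setPair_of_ne _ _ _ _ _ hij, ← hF]
    rw [htr s hs]
    have := mul_nonneg (hquot s hs) (sub_pos.2 hκ).le
    rw [abs_of_nonneg (by linarith)]
    linarith
  · have hdeg : ¬ (2 * β * (α + β * E.val.trace) = β ^ 2 * E.val.trace ∧
        (α + β * E.val.trace) ^ 2 = β ^ 2) := by
      rintro ⟨h1, h2⟩
      by_cases hβ : β = 0
      · have hα : α = 0 := by simpa [hβ] using h2
        have := X.det_coe
        rw [hαβ, hα, hβ] at this
        simp at this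
      · have h3 : 2 * (α + β * E.val.trace) = β * E.val.trace :=
          mul_left_cancel₀ hβ (by linear_combination h1)
        have h4 : E.val.trace ^ 2 = 4 :=
          mul_left_cancel₀ (pow_ne_zero 2 hβ) (by
            linear_combination 4 * h2 - (2 * (α + β * E.val.trace) + β * E.val.trace) * h3)
        rw [← sq_abs] at h4
        nlinarith [abs_nonneg E.val.trace]
    have h0 : (0 : ℝ) ∈ Set.Icc 0 (centralizerTime E) := ⟨le_rfl, (centralizerTime_pos E).le⟩
    obtain ⟨s, hs, hsε, hne⟩ := exists_div_ne hdeg (centralizerTime_pos E)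
      (fun s hs => det_pos_of_mem hs) hε
    refine ⟨s, hs, hsε, ?_⟩
    simp only [Function.eval, setPair_partner, setPair_of_ne _ _ _ _ _ hij, ← hF]
    rw [htr s hs, htr 0 h0]
    refine abs_two_add_ne (sub_pos.2 hκ) (hquot s hs) (hquot 0 h0) ?_
    simpa using hne

/-- The unipotent matrix with upper right entry `s`. -/
def unipotent (s : ℝ) : SL(2, ℝ) := ⟨!![1, s; 0, 1], by simp [Matrix.det_fin_two_of]⟩

theorem continuous_unipotent : Continuous unipotent := by
  refine continuous_induced_rng.2 (continuous_matrix fun i j => ?_)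
  fin_cases i <;> fin_cases j <;> simp <;> fun_prop

theorem unipotent_zero : unipotent 0 = 1 := by
  apply Subtype.ext
  ext i j
  fin_cases i <;> fin_cases j <;> simp [unipotent]

/-- Conjugation by a nontrivial unipotent moves the fixed point of an elliptic element. -/
theorem not_commute_unipotent_conj {E F : SL(2, ℝ)} (hE : |E.val.trace| < 2)
    (hF : |F.val.trace| < 2) (h : Commute E F) {s : ℝ} (hs : s ≠ 0) :
    ¬ Commute (unipotent s * E * (unipotent s)⁻¹) F := by
  intro h'
  have hE0 := entry_ne_zero_of_elliptic hE
  have hF0 := entry_ne_zero_of_elliptic hF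
  have hv : (unipotent s * E * (unipotent s)⁻¹).val =
      !![1, s; 0, 1] * E.val * !![1, -s; 0, 1] := by
    rw [Matrix.SpecialLinearGroup.coe_mul, Matrix.SpecialLinearGroup.coe_mul,
      Matrix.SpecialLinearGroup.coe_inv]
    simp only [unipotent, Matrix.adjugate_fin_two_of, neg_zero]
  have h1 : (E.val * F.val) 1 0 = (F.val * E.val) 1 0 :=
    congrFun (congrFun (congrArg Subtype.val h.eq) 1) 0
  have h2 : ((unipotent s * E * (unipotent s)⁻¹).val * F.val) 1 0 =
      (F.val * (unipotent s * E * (unipotent s)⁻¹).val) 1 0 :=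
    congrFun (congrFun (congrArg Subtype.val h'.eq) 1) 0
  rw [hv] at h2
  simp only [Matrix.mul_apply, Fin.sum_univ_two, Matrix.of_apply, Matrix.cons_val',
    Matrix.cons_val_zero, Matrix.cons_val_one, Matrix.cons_val_fin_one] at h1 h2
  have h3 : s * (E.val 1 0 * F.val 1 0) = 0 := by linarith
  simp [hs, hE0, hF0] at h3

/-- The case of elliptic elements `E` and `F` in different pairs: if they share their fixed point,
the commuting pair of `E` is first conjugated by a small unipotent matrix. -/
theorem mem_closure_of_elliptic {g : ℕ} {A : Fin (2 * g) → SL(2, ℝ)}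
    (hA : A ∈ surfaceTuples g) {i j : Fin g} (hij : j ≠ i) (b c : Bool)
    (hE : |(A (pairIdx i b)).val.trace| < 2) (hF : |(A (pairIdx j c)).val.trace| < 2)
    (hcomm : Commute (A (pairIdx i b)) (A (pairIdx i !b))) (n : ℕ) :
    A ∈ closure (surfaceTuples g ∩ smallGapTuples (2 * g) n) := by
  by_cases hEF : Commute (A (pairIdx i b)) (A (pairIdx j c))
  swap
  · exact mem_closure_of_elliptic_of_not_commute hA hij b c hE hcomm hEF n
  set a : ℝ → Fin (2 * g) → SL(2, ℝ) := fun s =>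
    setPair A i b (unipotent s * A (pairIdx i b) * (unipotent s)⁻¹)
      (unipotent s * A (pairIdx i !b) * (unipotent s)⁻¹) with ha
  have hac : Continuous a := by
    have hc : ∀ B : SL(2, ℝ), Continuous fun s => unipotent s * B * (unipotent s)⁻¹ := fun B =>
      (continuous_unipotent.mul continuous_const).mul continuous_unipotent.inv
    exact (continuous_setPair A i b).comp ((hc _).prodMk (hc _))
  have ha0 : a 0 = A := by simp [ha, unipotent_zero, setPair_eq_self]
  have hlim : Filter.Tendsto a (nhdsWithin 0 (Set.Ioi 0)) (nhds A) := by
    have := hac.tendsto 0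
    rw [ha0] at this
    exact this.mono_left nhdsWithin_le_nhds
  refine isClosed_closure.mem_of_tendsto hlim ?_
  filter_upwards [self_mem_nhdsWithin] with s hs
  have hconj : Commute (unipotent s * A (pairIdx i b) * (unipotent s)⁻¹)
      (unipotent s * A (pairIdx i !b) * (unipotent s)⁻¹) := by
    have := hcomm.map (MulAut.conj (unipotent s))
    simpa using this
  apply mem_closure_of_elliptic_of_not_commute (i := i) (j := j) (hij := hij) (b := b) (c := c)
  · apply setPair_mem_surfaceTuples hA
    rw [commutator_eq_one_of_commute hconj, commutator_eq_one_of_commute hcomm]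
  · simp only [ha, setPair_self]
    convert hE using 2
    rw [Matrix.SpecialLinearGroup.coe_mul, Matrix.trace_mul_comm,
      ← Matrix.SpecialLinearGroup.coe_mul]
    exact congrArg (fun B : SL(2, ℝ) => B.val.trace) (inv_mul_cancel_left _ _)
  · simpa only [ha, setPair_self, setPair_partner] using hconj
  · simp only [ha, setPair_self, setPair_of_ne _ _ _ _ _ hij]
    exact not_commute_unipotent_conj hE hF hEF (ne_of_gt hs)

/-! ### Density -/

/-- Tuples with small gaps are dense in the representation variety. -/
theorem mem_closure_smallGapTuples {g : ℕ} (hg : 2 ≤ g) {A : Fin (2 * g) → SL(2, ℝ)}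
    (hA : A ∈ surfaceTuples g) (n : ℕ) :
    A ∈ closure (surfaceTuples g ∩ smallGapTuples (2 * g) n) := by
  have hsymm : ∀ i b, (⁅A (pairIdx i b), A (pairIdx i !b)⁆).val.trace =
      (⁅A (pairIdx i false), A (pairIdx i true)⁆).val.trace := by
    intro i b
    cases b
    · rfl
    · exact trace_commutator_comm _ _
  by_cases h1 : ∃ i, 2 < (⁅A (pairIdx i false), A (pairIdx i true)⁆).val.trace
  · obtain ⟨i, hi⟩ := h1
    by_cases hxz : (A (pairIdx i false)).val.trace = 0 ∧
        ((A (pairIdx i false)).val * (A (pairIdx i !false)).val).trace = 0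
    · refine mem_closure_of_two_lt_trace_commutator hA i true (by rwa [hsymm]) (fun h => ?_) n
      -- otherwise all three traces vanish, and Fricke's identity gives `tr ⁅X, Y⁆ = -2`
      rw [trace_commutator_eq, h.1, hxz.1] at hi
      have := hxz.2
      rw [Bool.not_false] at this
      rw [this] at hi
      norm_num at hi
    · exact mem_closure_of_two_lt_trace_commutator hA i false hi hxz n
  push Not at h1
  by_cases h2 : ∃ i b, 2 < |(A (pairIdx i b)).val.trace|
  · obtain ⟨i, b, h⟩ := h2
    refine mem_closure_of_hyperbolic hA i (!b) (by rw [hsymm]; exact h1 i) ?_ n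
    rwa [Bool.not_not]
  push Not at h2
  by_cases h3 : ∃ i, ∀ b, |(A (pairIdx i b)).val.trace| = 2
  · obtain ⟨i, h⟩ := h3
    exact mem_closure_of_parabolic hA i (h1 i) h n
  push Not at h3
  obtain ⟨b, hb⟩ := h3 ⟨0, by omega⟩
  obtain ⟨c, hc⟩ := h3 ⟨1, by omega⟩
  have hE := (h2 _ b).lt_of_ne hb
  refine mem_closure_of_elliptic hA (by simp) b c hE ((h2 _ c).lt_of_ne hc) ?_ n
  by_contra hcomm
  have := two_lt_trace_commutator_of_elliptic hE hcomm
  rw [hsymm] at this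
  exact (h1 _).not_gt this

theorem mainTheorem3 (g : ℕ) (hg : 2 ≤ g) :
    {A : surfaceTuples g |
      ¬ ExponentiallySeparated (lengthSpectrum (Subgroup.closure (Set.range A.val)))} ∈
      residual (surfaceTuples g) := by
  have h : ∀ n : ℕ, {A : surfaceTuples g | A.val ∈ smallGapTuples (2 * g) n} ∈
      residual (surfaceTuples g) := by
    intro n
    refine residual_of_dense_open ((isOpen_smallGapTuples _ n).preimage continuous_subtype_val) ?_
    rw [Subtype.dense_iff]
    intro A hA
    refine closure_mono ?_ (mem_closure_smallGapTuples hg hA n)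
    exact fun B hB => ⟨⟨B, hB.1⟩, hB.2, rfl⟩
  filter_upwards [countable_iInter_mem.2 h] with A hA
  exact not_exponentiallySeparated fun n => Set.mem_iInter.1 hA n
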